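/- Let $\mathbf{x}=\{x_1,x_2,\ldots\}$ be countably many indeterminates. For $k\ge 0$ let $e_k=\sum_{j_1<\cdots<j_k}x_{j_1}\cdots x_{j_k}$ (so $e_0=1$), and let $e_k=0$ for $k<0$. For a partition $\lambda$ with conjugate $\lambda'$, let $s_\lambda=\det\bigl(e_{\lambda'_i-i+j}\bigr)_{1\le i,j\le \ell(\lambda')}$ be the Schur function, where $\ell$ denotes the number of parts of a partition. For a finite simple graph $G$ let $X_G=\sum_{\kappa}\prod_{v\in V(G)}x_{\kappa(v)}$ be its chromatic symmetric function, where $\kappa$ ranges over all proper colorings $\kappa:V(G)\to\{1,2,\ldots\}$. Then $X_G$ has a unique expansion $X_G=\sum_\lambda c_\lambda s_\lambda$ as a finite rational linear combination of Schur functions; write $[s_\lambda]X_G=c_\lambda$. Call $X_G$ 2-Schur-positive if $[s_\lambda]X_G\ge 0$ for all partitions $\lambda$ with $\ell(\lambda)\le 2$. A bipartition of $G$ is a decomposition of $V(G)$ into two disjoint, possibly empty, independent sets; it has type $(k,l)$ if the two sets have $k\ge l$ elements. (1) If $G$ is connected (in particular nonempty) and bipartite, then $G$ has exactly one bipartition,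 up to interchanging the two sets. Let $(k,l)$, $k\ge l$, be its type. Then $X_G$ is 2-Schur-positive if and only if this bipartition is balanced, i.e. $l\le k\le l+1$. Equivalently, $X_G$ is not 2-Schur-positive if and only if $k\ge l+2$. (2) If $G$ is not bipartite (connected or not), then $[s_\lambda]X_G=0$ for all partitions $\lambda$ with $\ell(\lambda)\le 2$. -/

import Mathlib

noncomputable section

namespace ChromaticSchur

/-- The formal power series `∑_{i : ι} x ^ (w i)` with rational coefficients in the countably many
indeterminates `x_0, x_1, x_2, …`, for a family of exponent vectors `w` with finite fibres: the
coefficient of `x ^ d` is the number of indices `i` with `w i = d`. -/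
def monomialSum {ι : Type*} (w : ι → (ℕ →₀ ℕ)) : MvPowerSeries ℕ ℚ :=
  fun d => (Nat.card {i : ι // w i = d} : ℚ)

/-- The elementary symmetric function `e_k = ∑_{j_1 < ⋯ < j_k} x_{j_1} ⋯ x_{j_k}`, the sum of the
squarefree monomials `∏_{j ∈ S} x_j` over all `k`-element sets `S` of indices. In particular
`e_0 = 1`. -/
def elemSymm (k : ℕ) : MvPowerSeries ℕ ℚ :=
  monomialSum fun S : {S : Finset ℕ // S.card = k} => ∑ j ∈ S.1, Finsupp.single j 1

/-- `e_k` for an integer `k`, with `e_k = 0` for `k < 0`. -/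
def elemSymmInt (k : ℤ) : MvPowerSeries ℕ ℚ :=
  if 0 ≤ k then elemSymm k.toNat else 0

/-- The Schur function `s_μ`, by the dual Jacobi–Trudi formula
`s_μ = det (e_{μ'_i - i + j})_{1 ≤ i, j ≤ ℓ(μ')}`, where `μ'` is the conjugate partition:
`μ'_i` is the length of the `i`-th column of `μ`, and `ℓ(μ')` is the length of the first row.
Partitions are represented by their Young diagrams. -/
def schur (μ : YoungDiagram) : MvPowerSeries ℕ ℚ :=
  Matrix.det (Matrix.of fun i j : Fin (μ.rowLen 0) =>
    elemSymmInt ((μ.colLen i : ℤ) - (i : ℤ) + (j : ℤ)))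

/-- The length `ℓ(μ)` of a partition: its number of (nonzero) parts, that is, of rows. -/
def length (μ : YoungDiagram) : ℕ := μ.colLen 0

/-- `f = ∑_μ c_μ s_μ`, a finite linear combination of Schur functions. -/
def IsSchurExpansion (f : MvPowerSeries ℕ ℚ) (c : YoungDiagram →₀ ℚ) : Prop :=
  f = c.sum fun μ a => a • schur μ

open Classical in
/-- The coefficient `[s_μ] f` of `s_μ` in the expansion of the symmetric function `f` in the basis
of Schur functions (`0` by convention if the power series `f` has no such expansion). -/
def schurCoeff (f : MvPowerSeries ℕ ℚ) (μ : YoungDiagram) : ℚ :=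
  if h : ∃ c, IsSchurExpansion f c then h.choose μ else 0

/-- `f` is 2-Schur-positive: `[s_μ] f ≥ 0` for all partitions `μ` of length at most `2`. -/
def IsTwoSchurPositive (f : MvPowerSeries ℕ ℚ) : Prop :=
  ∀ μ : YoungDiagram, length μ ≤ 2 → 0 ≤ schurCoeff f μ

/-- `f` is 2-Schur-zero: `[s_μ] f = 0` for all partitions `μ` of length at most `2`. -/
def IsTwoSchurZero (f : MvPowerSeries ℕ ℚ) : Prop :=
  ∀ μ : YoungDiagram, length μ ≤ 2 → schurCoeff f μ = 0

/-- The chromatic symmetric function `X_G = ∑_κ ∏_v x_{κ(v)}` of a finite graph `G`, the sum being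
over all proper colorings `κ` of `G` with colors in the index set of the indeterminates. -/
def chromaticSymm {V : Type*} [Fintype V] (G : SimpleGraph V) : MvPowerSeries ℕ ℚ :=
  monomialSum fun κ : G.Coloring ℕ => ∑ v, Finsupp.single (κ v) 1

/-- `(A, B)` is a bipartition of `G`: the vertex set is the disjoint union of the independent sets
`A` and `B` (one of which may be empty). -/
def IsBipartition {V : Type*} (G : SimpleGraph V) (A B : Set V) : Prop :=
  IsCompl A B ∧ G.IsIndepSet A ∧ G.IsIndepSet B

end ChromaticSchur

end

noncomputable section

namespace ChromaticSchur

open Finset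

/-! Set every variable except x = x_0 and y = x_1 to zero. Schur functions with more than two rows
vanish, and (x - y) s_(a,b) becomes x^(a+1) y^b - x^b y^(a+1). So [s_(a,b)] f is the coefficient of
x^(a+1) y^b in (x - y) f(x, y), that is [x^a y^b] f - [x^(a+1) y^(b-1)] f, with no second term when
b = 0 (`twoRowCoeff_schur`).

For f = X_G, the coefficient of x^a y^b is nonzero exactly when G has an ordered bipartition with
parts of sizes a and b. If G is not bipartite, all of these vanish. If G is connected of type (k,l),
only (k,l) and (l,k) survive: for k ≥ l + 2 the shape (k-1,l+1) gets a negative coefficient, while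
for k ≤ l + 1 the subtracted term never occurs, since its exponents differ by at least two.

That the Schur expansion exists and is unique comes from unitriangularity. For the weight `wt`, the
monomial x^μ is the unique lightest one in s_μ and has coefficient 1
(`wt_le_of_coeff_prod_ne_zero`). Hence the s_μ are independent, and in each degree, where there are
finitely many partitions, they span the symmetric series. -/

/-- The exponent vector of the squarefree monomial `∏_{j ∈ S} x_j`. -/
def indVec (S : Finset ℕ) : ℕ →₀ ℕ := ∑ j ∈ S, Finsupp.single j 1

theorem indVec_apply (S : Finset ℕ) (i : ℕ) : indVec S i = if i ∈ S then 1 else 0 := by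
  simp [indVec, Finsupp.finsetSum_apply, Finsupp.single_apply]

theorem indVec_injective : Function.Injective indVec := by
  intro S T h
  ext i
  have := DFunLike.congr_fun h i
  rw [indVec_apply, indVec_apply] at this
  by_cases hS : i ∈ S <;> by_cases hT : i ∈ T <;> simp_all

theorem degree_indVec (S : Finset ℕ) : (indVec S).degree = S.card := by
  simp [indVec, map_sum]

/-- The weight `∑ j, j * d j` of an exponent vector. -/
def wt : (ℕ →₀ ℕ) →+ ℕ := Finsupp.weight id

theorem wt_indVec (S : Finset ℕ) : wt (indVec S) = ∑ j ∈ S, j := by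
  simp [wt, indVec, map_sum, Finsupp.weight_single]

/-! ### Monomials of elementary symmetric functions and their products -/

theorem coeff_monomialSum {ι : Type*} (w : ι → (ℕ →₀ ℕ)) (d : ℕ →₀ ℕ) :
    MvPowerSeries.coeff d (monomialSum w) = (Nat.card {i : ι // w i = d} : ℚ) := rfl

theorem coeff_elemSymm_indVec (S : Finset ℕ) :
    MvPowerSeries.coeff (indVec S) (elemSymm S.card) = 1 := by
  rw [elemSymm, coeff_monomialSum, Nat.cast_eq_one, Nat.card_eq_one_iff_unique]
  refine ⟨⟨fun a b => ?_⟩, ⟨⟨⟨S, rfl⟩, rfl⟩⟩⟩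
  exact Subtype.ext (Subtype.ext (indVec_injective (a.2.trans b.2.symm)))

theorem exists_of_coeff_elemSymm_ne_zero {k : ℕ} {d : ℕ →₀ ℕ}
    (h : MvPowerSeries.coeff d (elemSymm k) ≠ 0) : ∃ S : Finset ℕ, S.card = k ∧ d = indVec S := by
  rw [elemSymm, coeff_monomialSum, Nat.cast_ne_zero, Nat.card_ne_zero] at h
  obtain ⟨⟨⟨S, hS⟩, hd⟩⟩ := h.1
  exact ⟨S, hS, hd.symm⟩

theorem elemSymmInt_natCast (k : ℕ) : elemSymmInt k = elemSymm k := by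
  simp [elemSymmInt]

theorem elemSymmInt_of_neg {k : ℤ} (h : k < 0) : elemSymmInt k = 0 := by
  simp [elemSymmInt, h]

theorem exists_of_coeff_elemSymmInt_ne_zero {k : ℤ} {d : ℕ →₀ ℕ}
    (h : MvPowerSeries.coeff d (elemSymmInt k) ≠ 0) :
    ∃ S : Finset ℕ, (S.card : ℤ) = k ∧ d = indVec S := by
  rcases lt_or_ge k 0 with hk | hk
  · simp [elemSymmInt_of_neg hk] at h
  · lift k to ℕ using hk
    rw [elemSymmInt_natCast] at h
    simpa using exists_of_coeff_elemSymm_ne_zero h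

theorem exists_of_coeff_prod_elemSymmInt_ne_zero {ι : Type*} [Fintype ι] {k : ι → ℤ}
    {d : ℕ →₀ ℕ} (h : MvPowerSeries.coeff d (∏ i, elemSymmInt (k i)) ≠ 0) :
    ∃ S : ι → Finset ℕ, (∀ i, ((S i).card : ℤ) = k i) ∧ d = ∑ i, indVec (S i) := by
  classical
  rw [MvPowerSeries.coeff_prod] at h
  obtain ⟨l, hl, hne⟩ := Finset.exists_ne_zero_of_sum_ne_zero h
  rw [Finset.prod_ne_zero_iff] at hne
  choose S hS using fun i => exists_of_coeff_elemSymmInt_ne_zero (hne i (mem_univ i))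
  refine ⟨S, fun i => (hS i).1, ?_⟩
  rw [mem_finsuppAntidiag] at hl
  rw [← hl.1]
  exact Finset.sum_congr rfl fun i _ => (hS i).2

/-- Induction by removing the maximum, which is at least k in a set of k + 1 naturals; equality
forces it to be k. -/
theorem sum_range_le_sum_and_eq (k : ℕ) : ∀ S : Finset ℕ, S.card = k →
    ∑ i ∈ range k, i ≤ ∑ i ∈ S, i ∧ (∑ i ∈ S, i ≤ ∑ i ∈ range k, i → S = range k) := by
  induction k with
  | zero => intro S hS; simp_all
  | succ k ih =>
    intro S hS
    have hne : S.Nonempty := by rw [← card_pos]; omega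
    have hm := S.max'_mem hne
    have hle : k ≤ S.max' hne := by
      by_contra! hlt
      have : S ⊆ range k := fun i hi => mem_range.2 ((S.le_max' i hi).trans_lt hlt)
      have := card_le_card this
      simp at this
      omega
    obtain ⟨h1, h2⟩ := ih (S.erase (S.max' hne)) (by rw [card_erase_of_mem hm]; omega)
    have h3 := sum_erase_add S (fun i => i) hm
    rw [sum_range_succ]
    refine ⟨by omega, fun h => ?_⟩
    have h4 := h2 (by omega)
    rw [← insert_erase hm, h4, range_add_one]
    congr 1
    omega

/-! ### Unitriangularity of Schur functions in the monomials x^μ -/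

/-- The exponent vector `i ↦ μ_i` of a partition, as a sum over its columns. -/
def rowVec (μ : YoungDiagram) : ℕ →₀ ℕ :=
  ∑ j : Fin (μ.rowLen 0), indVec (range (μ.colLen j))

theorem rowVec_apply (μ : YoungDiagram) (i : ℕ) : rowVec μ i = μ.rowLen i := by
  simp only [rowVec, Finsupp.finsetSum_apply, indVec_apply, mem_range,
    ← YoungDiagram.mem_iff_lt_colLen, YoungDiagram.mem_iff_lt_rowLen]
  rw [Fin.sum_univ_eq_sum_range (fun j => if j < μ.rowLen i then 1 else 0) (μ.rowLen 0),
    Finset.sum_boole, Nat.cast_id]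
  have : ({x ∈ range (μ.rowLen 0) | x < μ.rowLen i} : Finset ℕ) = range (μ.rowLen i) := by
    ext j
    have := μ.rowLen_anti 0 i (Nat.zero_le i)
    simp only [mem_filter, mem_range]
    omega
  rw [this, card_range]

theorem rowVec_injective : Function.Injective rowVec := by
  intro μ ν h
  ext ⟨i, j⟩
  rw [YoungDiagram.mem_cells, YoungDiagram.mem_cells, YoungDiagram.mem_iff_lt_rowLen,
    YoungDiagram.mem_iff_lt_rowLen, ← rowVec_apply, h, rowVec_apply]

/-- The entry index `μ'_i - i + j` summand depending on the row of the dual Jacobi–Trudi matrix. -/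
def rowShift (μ : YoungDiagram) (i : Fin (μ.rowLen 0)) : ℤ := (μ.colLen i : ℤ) - (i : ℤ)

theorem schur_eq_sum (μ : YoungDiagram) :
    schur μ = ∑ σ : Equiv.Perm (Fin (μ.rowLen 0)), (Equiv.Perm.sign σ : ℤ) •
      ∏ i : Fin (μ.rowLen 0), elemSymmInt (rowShift μ (σ i) + (i : ℤ)) := by
  rw [schur, Matrix.det_apply]
  rfl

theorem rowShift_strictAnti (μ : YoungDiagram) : StrictAnti (rowShift μ) := by
  intro i j hij
  have := μ.colLen_anti i j hij.le
  have : (i : ℕ) < j := hij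
  simp only [rowShift]
  omega

theorem coeff_schur (μ : YoungDiagram) (d : ℕ →₀ ℕ) :
    MvPowerSeries.coeff d (schur μ) = ∑ σ : Equiv.Perm (Fin (μ.rowLen 0)),
      (Equiv.Perm.sign σ : ℤ) • MvPowerSeries.coeff d
        (∏ i : Fin (μ.rowLen 0), elemSymmInt (rowShift μ (σ i) + (i : ℤ))) := by
  rw [schur_eq_sum, map_sum]
  exact Finset.sum_congr rfl fun σ _ => map_zsmul _ _ _

theorem sum_rowShift_perm (μ : YoungDiagram) (σ : Equiv.Perm (Fin (μ.rowLen 0))) :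
    ∑ i : Fin (μ.rowLen 0), (rowShift μ (σ i) + (i : ℤ)) =
      ∑ i : Fin (μ.rowLen 0), (μ.colLen i : ℤ) := by
  rw [sum_add_distrib, Equiv.sum_comp σ (rowShift μ), ← sum_add_distrib]
  simp [rowShift]

theorem degree_eq_of_coeff_schur_ne_zero {μ : YoungDiagram} {d : ℕ →₀ ℕ}
    (h : MvPowerSeries.coeff d (schur μ) ≠ 0) : d.degree = (rowVec μ).degree := by
  rw [coeff_schur] at h
  obtain ⟨σ, -, hσ⟩ := exists_ne_zero_of_sum_ne_zero h
  obtain ⟨S, hS, rfl⟩ := exists_of_coeff_prod_elemSymmInt_ne_zero (right_ne_zero_of_smul hσ)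
  have := sum_rowShift_perm μ σ
  simp only [← hS] at this
  simp only [rowVec, map_sum, degree_indVec, card_range]
  exact_mod_cast this

/-- After expanding the squares, only the cross term depends on σ. By the rearrangement inequality
it is least at the identity, and only there because `rowShift` is strictly decreasing. -/
theorem sum_sq_rowShift_perm (μ : YoungDiagram) (σ : Equiv.Perm (Fin (μ.rowLen 0))) :
    ∑ i : Fin (μ.rowLen 0), (μ.colLen i : ℤ) ^ 2 ≤
        ∑ i : Fin (μ.rowLen 0), (rowShift μ (σ i) + (i : ℤ)) ^ 2 ∧
      (∑ i : Fin (μ.rowLen 0), (rowShift μ (σ i) + (i : ℤ)) ^ 2 ≤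
        ∑ i : Fin (μ.rowLen 0), (μ.colLen i : ℤ) ^ 2 → σ = 1) := by
  have hanti : Antivary (rowShift μ) (fun i : Fin (μ.rowLen 0) => (i : ℤ)) := by
    intro i j hij
    exact (rowShift_strictAnti μ).antitone (by simpa using hij : i < j).le
  have h1 : ∑ i : Fin (μ.rowLen 0), (rowShift μ (σ i) + (i : ℤ)) ^ 2 =
      ∑ i : Fin (μ.rowLen 0), (rowShift μ i) ^ 2 + 2 * ∑ i, rowShift μ (σ i) * (i : ℤ) +
      ∑ i : Fin (μ.rowLen 0), (i : ℤ) ^ 2 := by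
    rw [← Equiv.sum_comp σ (fun i => rowShift μ i ^ 2), mul_sum, ← sum_add_distrib,
      ← sum_add_distrib]
    exact sum_congr rfl fun i _ => by ring
  have h2 : ∑ i : Fin (μ.rowLen 0), (μ.colLen i : ℤ) ^ 2 =
      ∑ i : Fin (μ.rowLen 0), (rowShift μ i) ^ 2 + 2 * ∑ i, rowShift μ i * (i : ℤ) +
      ∑ i : Fin (μ.rowLen 0), (i : ℤ) ^ 2 := by
    rw [mul_sum, ← sum_add_distrib, ← sum_add_distrib]
    exact sum_congr rfl fun i _ => by simp only [rowShift]; ring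
  have h3 := hanti.sum_mul_le_sum_comp_perm_mul (σ := σ)
  refine ⟨by linarith, fun h => ?_⟩
  -- Equality makes `rowShift μ ∘ σ` antivary with the index, so σ is increasing, and an increasing
  -- permutation is the identity.
  have h4 := (hanti.sum_comp_perm_mul_eq_sum_mul_iff (σ := σ)).1 (by linarith)
  have hmono : StrictMono σ := by
    intro i j hij
    refine lt_of_le_of_ne ?_ (σ.injective.ne hij.ne)
    by_contra! hlt
    exact absurd (h4 (show ((i : ℕ) : ℤ) < ((j : ℕ) : ℤ) by exact_mod_cast hij))
      (not_le.2 (rowShift_strictAnti μ hlt))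
  ext i
  exact congrArg Fin.val (congrFun
    ((hmono.range_inj strictMono_id).1 (by simp [σ.surjective.range_eq])) i)

theorem two_mul_sum_range (k : ℕ) : 2 * ((∑ i ∈ range k, i : ℕ) : ℤ) = (k : ℤ) ^ 2 - k := by
  induction k with
  | zero => simp
  | succ k ih => rw [sum_range_succ]; push_cast at *; linarith

theorem two_mul_wt_rowVec (μ : YoungDiagram) : 2 * (wt (rowVec μ) : ℤ) =
    ∑ i : Fin (μ.rowLen 0), (μ.colLen i : ℤ) ^ 2 - ∑ i : Fin (μ.rowLen 0), (μ.colLen i : ℤ) := by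
  rw [rowVec, map_sum, Nat.cast_sum, mul_sum, ← sum_sub_distrib]
  exact sum_congr rfl fun i _ => by rw [wt_indVec, two_mul_sum_range]

/-- Two minimizations combine: for fixed sizes k_i the lightest sets are initial segments, of total
weight (∑ k_i² - ∑ k_i)/2; and ∑ k_i does not depend on σ, while ∑ k_i² is least only at σ = 1. -/
theorem wt_le_of_coeff_prod_ne_zero {μ : YoungDiagram} {d : ℕ →₀ ℕ}
    {σ : Equiv.Perm (Fin (μ.rowLen 0))} (h : MvPowerSeries.coeff d
      (∏ i : Fin (μ.rowLen 0), elemSymmInt (rowShift μ (σ i) + (i : ℤ))) ≠ 0) :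
    wt (rowVec μ) ≤ wt d ∧ (wt d ≤ wt (rowVec μ) → σ = 1 ∧ d = rowVec μ) := by
  obtain ⟨S, hS, rfl⟩ := exists_of_coeff_prod_elemSymmInt_ne_zero h
  have hmu := two_mul_wt_rowVec μ
  have hs := sum_rowShift_perm μ σ
  obtain ⟨hq1, hq2⟩ := sum_sq_rowShift_perm μ σ
  simp only [← hS] at hs hq1 hq2
  have hlow : ∑ i, ∑ j ∈ range (S i).card, j ≤ ∑ i, ∑ j ∈ S i, j :=
    sum_le_sum fun i _ => (sum_range_le_sum_and_eq _ (S i) rfl).1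
  have hval : 2 * ((∑ i, ∑ j ∈ range (S i).card, j : ℕ) : ℤ) =
      ∑ i, ((S i).card : ℤ) ^ 2 - ∑ i, ((S i).card : ℤ) := by
    rw [Nat.cast_sum, mul_sum, ← sum_sub_distrib]
    exact sum_congr rfl fun i _ => two_mul_sum_range _
  simp only [map_sum, wt_indVec]
  refine ⟨by zify at hlow ⊢; push_cast at *; linarith, fun hle => ?_⟩
  have hσ : σ = 1 := hq2 (by zify at hlow hle; push_cast at *; linarith)
  refine ⟨hσ, ?_⟩
  subst hσ
  have hcard : ∀ i, (S i).card = μ.colLen i := fun i => by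
    have := hS i
    simp [rowShift] at this
    exact this
  have heq : ∀ i, S i = range (S i).card := by
    have h1 : ∑ i, ∑ j ∈ range (S i).card, j = ∑ i, ∑ j ∈ S i, j := by
      refine le_antisymm hlow (hle.trans_eq ?_)
      simp only [rowVec, map_sum, wt_indVec, hcard]
    rw [sum_eq_sum_iff_of_le fun i _ => (sum_range_le_sum_and_eq _ (S i) rfl).1] at h1
    exact fun i => (sum_range_le_sum_and_eq _ (S i) rfl).2 (h1 i (mem_univ i)).ge
  exact sum_congr rfl fun i _ => by rw [heq i, hcard]

theorem coeff_rowVec_prod (μ : YoungDiagram) : MvPowerSeries.coeff (rowVec μ)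
    (∏ i : Fin (μ.rowLen 0), elemSymm (μ.colLen i)) = 1 := by
  classical
  rw [MvPowerSeries.coeff_prod]
  have key : ∀ i, MvPowerSeries.coeff (indVec (range (μ.colLen i))) (elemSymm (μ.colLen i)) = 1 :=
    fun i => by simpa using coeff_elemSymm_indVec (range (μ.colLen i))
  rw [Finset.sum_eq_single (Finsupp.equivFunOnFinite.symm
    fun i : Fin (μ.rowLen 0) => indVec (range (μ.colLen i)))]
  · simp [key]
  · intro l hl hne
    by_contra h0
    rw [← ne_eq, prod_ne_zero_iff] at h0
    choose S hS using fun i => exists_of_coeff_elemSymm_ne_zero (h0 i (mem_univ i))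
    rw [mem_finsuppAntidiag] at hl
    have h1 : ∑ i : Fin (μ.rowLen 0), ∑ j ∈ range (μ.colLen i), j = ∑ i, ∑ j ∈ S i, j := by
      have := congrArg wt hl.1
      simp only [(hS _).2] at this
      simpa [rowVec, wt_indVec] using this.symm
    rw [sum_eq_sum_iff_of_le fun i _ => (sum_range_le_sum_and_eq _ (S i) (hS i).1).1] at h1
    refine hne (Finsupp.ext fun i => ?_)
    have := (sum_range_le_sum_and_eq _ (S i) (hS i).1).2 (h1 i (mem_univ i)).ge
    simp [(hS i).2, this]
  · intro h
    simp [mem_finsuppAntidiag, rowVec] at h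

theorem coeff_rowVec_schur_self (μ : YoungDiagram) :
    MvPowerSeries.coeff (rowVec μ) (schur μ) = 1 := by
  rw [coeff_schur, Finset.sum_eq_single 1]
  · have : ∀ i : Fin (μ.rowLen 0), elemSymmInt (rowShift μ i + (i : ℤ)) = elemSymm (μ.colLen i) :=
      fun i => by rw [← elemSymmInt_natCast]; congr 1; simp [rowShift]
    simp [this, coeff_rowVec_prod]
  · intro σ _ hσ
    by_contra h
    exact hσ ((wt_le_of_coeff_prod_ne_zero (right_ne_zero_of_smul h)).2 le_rfl).1
  · simp

theorem wt_lt_of_coeff_schur_ne_zero {μ ν : YoungDiagram}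
    (h : MvPowerSeries.coeff (rowVec ν) (schur μ) ≠ 0) :
    μ = ν ∨ wt (rowVec μ) < wt (rowVec ν) := by
  rw [coeff_schur] at h
  obtain ⟨σ, -, hσ⟩ := exists_ne_zero_of_sum_ne_zero h
  obtain ⟨h1, h2⟩ := wt_le_of_coeff_prod_ne_zero (right_ne_zero_of_smul hσ)
  rcases h1.eq_or_lt with h3 | h3
  · exact Or.inl (rowVec_injective (h2 h3.ge).2.symm)
  · exact Or.inr h3

/-! ### Linear independence of Schur functions -/

/-- In a vanishing combination, evaluate at an index of least `st` among those with nonzero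
coefficient: only the diagonal term survives. -/
theorem linearIndependent_of_triangular {ι : Type*} (K : ι → ι → ℚ) (st : ι → ℕ)
    (hdiag : ∀ i, K i i ≠ 0) (hK : ∀ i j, K i j ≠ 0 → i = j ∨ st i < st j) :
    LinearIndependent ℚ K := by
  classical
  rw [linearIndependent_iff']
  intro s g hg
  by_contra! hne
  obtain ⟨i₀, hi₀, hgi₀⟩ := hne
  obtain ⟨i, hi, hmin⟩ := exists_min_image ({i ∈ s | g i ≠ 0} : Finset ι) st
    ⟨i₀, by simp [hi₀, hgi₀]⟩
  rw [mem_filter] at hi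
  have h := congrFun hg i
  rw [Finset.sum_apply, Finset.sum_eq_single i] at h
  · simp [hi.2, hdiag] at h
  · intro j hj hji
    by_contra h0
    simp only [Pi.smul_apply, smul_eq_mul, mul_eq_zero, not_or] at h0
    have h1 := hmin j (by simp [hj, h0.1])
    rcases hK j i h0.2 with h2 | h2
    · exact hji h2
    · omega
  · exact fun h => absurd hi.1 h

/-- The coefficients of a power series at the exponent vectors of partitions. -/
def partCoeff : MvPowerSeries ℕ ℚ →ₗ[ℚ] (YoungDiagram → ℚ) :=
  LinearMap.pi fun ν => MvPowerSeries.coeff (rowVec ν)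

theorem partCoeff_apply (f : MvPowerSeries ℕ ℚ) (ν : YoungDiagram) :
    partCoeff f ν = MvPowerSeries.coeff (rowVec ν) f := rfl

theorem linearIndependent_schur : LinearIndependent ℚ schur := by
  refine LinearIndependent.of_comp partCoeff ?_
  refine linearIndependent_of_triangular _ (fun μ => wt (rowVec μ)) (fun μ => ?_) fun μ ν h => ?_
  · simp [partCoeff_apply, coeff_rowVec_schur_self]
  · exact wt_lt_of_coeff_schur_ne_zero h

/-! ### Symmetric series and existence of the Schur expansion -/

/-- Invariance of a power series under all permutations of the indeterminates. -/
def IsSymm (f : MvPowerSeries ℕ ℚ) : Prop :=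
  ∀ e : Equiv.Perm ℕ, MvPowerSeries.killCompl e.toEmbedding f = f

theorem IsSymm.coeff_embDomain {f : MvPowerSeries ℕ ℚ} (hf : IsSymm f) (e : Equiv.Perm ℕ)
    (d : ℕ →₀ ℕ) :
    MvPowerSeries.coeff (d.embDomain e.toEmbedding) f = MvPowerSeries.coeff d f := by
  rw [← MvPowerSeries.coeff_killCompl, hf e]

theorem isSymm_monomialSum {ι : Type*} (w : ι → (ℕ →₀ ℕ))
    (h : ∀ e : Equiv.Perm ℕ, ∃ φ : ι ≃ ι, ∀ i, w (φ i) = (w i).embDomain e.toEmbedding) :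
    IsSymm (monomialSum w) := by
  intro e
  obtain ⟨φ, hφ⟩ := h e
  ext d
  rw [MvPowerSeries.coeff_killCompl, coeff_monomialSum, coeff_monomialSum, Nat.cast_inj]
  refine (Nat.card_congr (φ.subtypeEquiv fun i => ?_)).symm
  rw [hφ, (Finsupp.embDomain_injective _).eq_iff]

theorem embDomain_sum_single {ι : Type*} (s : Finset ι) (κ : ι → ℕ) (e : Equiv.Perm ℕ) :
    (∑ v ∈ s, Finsupp.single (κ v) 1 : ℕ →₀ ℕ).embDomain e.toEmbedding =
      ∑ v ∈ s, Finsupp.single (e (κ v)) 1 := by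
  rw [Finsupp.embDomain_eq_mapDomain, Finsupp.mapDomain_finsetSum]
  simp [Finsupp.mapDomain_single]

theorem isSymm_elemSymm (k : ℕ) : IsSymm (elemSymm k) := by
  refine isSymm_monomialSum _ fun e => ⟨e.finsetCongr.subtypeEquiv fun S => by simp, fun S => ?_⟩
  rw [embDomain_sum_single]
  simp

theorem isSymm_elemSymmInt (k : ℤ) : IsSymm (elemSymmInt k) := by
  unfold elemSymmInt
  split_ifs
  · exact isSymm_elemSymm _
  · exact fun e => map_zero _

theorem isSymm_schur (μ : YoungDiagram) : IsSymm (schur μ) := by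
  intro e
  rw [schur_eq_sum, map_sum]
  refine sum_congr rfl fun σ _ => ?_
  rw [map_zsmul, map_prod]
  congr 1
  exact prod_congr rfl fun i _ => isSymm_elemSymmInt _ e

/-- The permutations of the colors act on proper colorings. -/
def recolor {V : Type*} (G : SimpleGraph V) (e : Equiv.Perm ℕ) : G.Coloring ℕ ≃ G.Coloring ℕ where
  toFun κ := SimpleGraph.Coloring.mk (fun v => e (κ v)) fun h => e.injective.ne (κ.valid h)
  invFun κ := SimpleGraph.Coloring.mk (fun v => e.symm (κ v)) fun h => e.symm.injective.ne (κ.valid h)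
  left_inv κ := by ext v; exact e.symm_apply_apply (κ v)
  right_inv κ := by ext v; exact e.apply_symm_apply (κ v)

theorem isSymm_chromaticSymm {V : Type*} [Fintype V] (G : SimpleGraph V) :
    IsSymm (chromaticSymm G) := by
  refine isSymm_monomialSum _ fun e => ⟨recolor G e, fun κ => ?_⟩
  rw [embDomain_sum_single]
  rfl

theorem degree_eq_of_coeff_chromaticSymm_ne_zero {V : Type*} [Fintype V] (G : SimpleGraph V)
    {d : ℕ →₀ ℕ} (h : MvPowerSeries.coeff d (chromaticSymm G) ≠ 0) :
    d.degree = Fintype.card V := by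
  rw [chromaticSymm, coeff_monomialSum, Nat.cast_ne_zero, Nat.card_ne_zero] at h
  obtain ⟨⟨κ, rfl⟩⟩ := h.1
  simp [map_sum]

/-- There is a Young diagram whose row lengths are given by an antitone finitely supported function. -/
theorem exists_rowVec_eq {d : ℕ →₀ ℕ} (hd : Antitone d) : ∃ μ, rowVec μ = d := by
  have hmem : ∀ c : ℕ × ℕ, c ∈ (d.support.biUnion fun i => {i} ×ˢ range (d i)) ↔ c.2 < d c.1 := by
    rintro ⟨i, j⟩
    simp only [mem_biUnion, Finsupp.mem_support_iff, mem_product, mem_singleton, mem_range]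
    constructor
    · rintro ⟨a, -, rfl, h⟩
      exact h
    · intro h
      exact ⟨i, by omega, rfl, h⟩
  refine ⟨⟨d.support.biUnion fun i => {i} ×ˢ range (d i), fun c c' hc h => ?_⟩, ?_⟩
  · rw [mem_coe, hmem] at h ⊢
    exact (hc.2.trans_lt h).trans_le (hd hc.1)
  · ext i
    rw [rowVec_apply]
    refine eq_of_forall_lt_iff fun j => ?_
    rw [← YoungDiagram.mem_iff_lt_rowLen]
    exact hmem (i, j)

/-- Sorting the exponents in decreasing order; thus a symmetric series is determined by its
coefficients at partitions. -/
theorem exists_perm_rowVec (d : ℕ →₀ ℕ) :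
    ∃ (e : Equiv.Perm ℕ) (μ : YoungDiagram), d = (rowVec μ).embDomain e.toEmbedding := by
  obtain ⟨m, hm⟩ : ∃ m, ∀ i, m ≤ i → d i = 0 := by
    refine ⟨d.support.sup id + 1, fun i hi => ?_⟩
    by_contra h
    have := le_sup (f := id) (Finsupp.mem_support_iff.2 h)
    simp only [id] at this
    omega
  let τ : Equiv.Perm (Fin m) := Tuple.sort fun i : Fin m => OrderDual.toDual (d i)
  have hτ : Antitone fun i => d (τ i) := fun i j hij =>
    Tuple.monotone_sort (fun i : Fin m => OrderDual.toDual (d i)) hij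
  let e : Equiv.Perm ℕ := τ.extendDomain Fin.equivSubtype
  have he : ∀ i (hi : i < m), e i = τ ⟨i, hi⟩ := fun i hi =>
    τ.extendDomain_apply_image Fin.equivSubtype ⟨i, hi⟩
  have he' : ∀ i, m ≤ i → e i = i := fun i hi =>
    τ.extendDomain_apply_not_subtype Fin.equivSubtype (not_lt.2 hi)
  have hanti : Antitone (d.equivMapDomain e.symm) := by
    intro i j hij
    rw [Finsupp.equivMapDomain_apply, Finsupp.equivMapDomain_apply, Equiv.symm_symm]
    rcases lt_or_ge j m with hj | hj
    · rw [he j hj, he i (hij.trans_lt hj)]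
      exact hτ (Fin.mk_le_mk.2 hij)
    · rw [he' j hj, hm j hj]
      exact Nat.zero_le _
  obtain ⟨μ, hμ⟩ := exists_rowVec_eq hanti
  refine ⟨e, μ, ?_⟩
  rw [hμ]
  ext i
  obtain ⟨i, rfl⟩ := e.surjective i
  exact (((d.equivMapDomain e.symm).embDomain_apply_self e.toEmbedding i).trans (by simp)).symm

theorem degree_embDomain (d : ℕ →₀ ℕ) (e : Equiv.Perm ℕ) :
    (d.embDomain e.toEmbedding).degree = d.degree := by
  rw [Finsupp.degree_apply, Finsupp.degree_apply, Finsupp.support_embDomain, sum_map]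
  simp only [Finsupp.embDomain_apply_self]

theorem finite_degree_rowVec (n : ℕ) : Finite {μ : YoungDiagram // (rowVec μ).degree = n} := by
  refine Finite.of_injective (β := (range n ×ˢ range n).powerset)
    (fun μ => ⟨μ.1.cells, ?_⟩) fun μ ν h => ?_
  · obtain ⟨μ, rfl⟩ := μ
    rw [mem_powerset]
    rintro ⟨i, j⟩ hij
    rw [YoungDiagram.mem_cells] at hij
    change (i, j) ∈ μ at hij
    have h1 := YoungDiagram.mem_iff_lt_rowLen.1 hij
    have h2 := YoungDiagram.mem_iff_lt_colLen.1 hij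
    have h3 := Finsupp.le_degree i (rowVec μ)
    rw [rowVec_apply] at h3
    have h4 : μ.colLen j ≤ (rowVec μ).degree := by
      have h0 := μ.rowLen_anti 0 i (Nat.zero_le i)
      simp only [rowVec, map_sum, degree_indVec, card_range]
      exact single_le_sum (f := fun j : Fin (μ.rowLen 0) => μ.colLen j)
        (fun _ _ => Nat.zero_le _) (mem_univ ⟨j, by omega⟩)
    simp only [mem_product, mem_range]
    omega
  · exact Subtype.ext (YoungDiagram.ext (congrArg Subtype.val h))

theorem isSchurExpansion_iff (f : MvPowerSeries ℕ ℚ) (c : YoungDiagram →₀ ℚ) :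
    IsSchurExpansion f c ↔ f = Finsupp.linearCombination ℚ schur c := Iff.rfl

theorem exists_isSchurExpansion {f : MvPowerSeries ℕ ℚ} (hf : IsSymm f) (n : ℕ)
    (hn : ∀ d, MvPowerSeries.coeff d f ≠ 0 → d.degree = n) : ∃ c, IsSchurExpansion f c := by
  classical
  have := finite_degree_rowVec n
  have := Fintype.ofFinite {μ : YoungDiagram // (rowVec μ).degree = n}
  let K : {μ : YoungDiagram // (rowVec μ).degree = n} →
      {μ : YoungDiagram // (rowVec μ).degree = n} → ℚ := fun μ ν => partCoeff (schur μ.1) ν.1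
  have hK : LinearIndependent ℚ K := by
    refine linearIndependent_of_triangular K (fun μ => wt (rowVec μ.1)) (fun μ => ?_) fun μ ν h => ?_
    · simp [K, partCoeff_apply, coeff_rowVec_schur_self]
    · exact (wt_lt_of_coeff_schur_ne_zero h).imp_left Subtype.ext
  -- The matrix is square, so its independent rows span; symmetry then extends the identity from
  -- partitions to all exponent vectors.
  have hspan := hK.span_eq_top_of_card_eq_finrank' (by simp)
  obtain ⟨c, hc⟩ := (Submodule.mem_span_range_iff_exists_fun ℚ).1
    (hspan ▸ Submodule.mem_top : (fun ν => partCoeff f ν.1) ∈ Submodule.span ℚ (Set.range K))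
  refine ⟨∑ μ, Finsupp.single μ.1 (c μ), ?_⟩
  rw [isSchurExpansion_iff, map_sum]
  simp only [Finsupp.linearCombination_single]
  ext d
  rw [map_sum]
  simp only [map_smul]
  by_cases hd : d.degree = n
  · obtain ⟨e, ν, rfl⟩ := exists_perm_rowVec d
    rw [degree_embDomain] at hd
    have h := congrFun hc ⟨ν, hd⟩
    simp only [(isSymm_schur _).coeff_embDomain, hf.coeff_embDomain]
    rw [Finset.sum_apply] at h
    exact h.symm
  · have h0 : MvPowerSeries.coeff d f = 0 := by
      by_contra h
      exact hd (hn d h)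
    rw [h0]
    refine (sum_eq_zero fun μ _ => ?_).symm
    have : MvPowerSeries.coeff d (schur μ.1) = 0 := by
      by_contra h
      exact hd ((degree_eq_of_coeff_schur_ne_zero h).trans μ.2)
    rw [this, smul_zero]

theorem IsSchurExpansion.unique {f : MvPowerSeries ℕ ℚ} {c c' : YoungDiagram →₀ ℚ}
    (h : IsSchurExpansion f c) (h' : IsSchurExpansion f c') : c = c' :=
  linearIndependent_schur (h.symm.trans h')

theorem IsSchurExpansion.schurCoeff_eq {f : MvPowerSeries ℕ ℚ} {c : YoungDiagram →₀ ℚ}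
    (h : IsSchurExpansion f c) (μ : YoungDiagram) : schurCoeff f μ = c μ := by
  have hex : ∃ c, IsSchurExpansion f c := ⟨c, h⟩
  rw [schurCoeff, dif_pos hex, hex.choose_spec.unique h]

theorem exists_isSchurExpansion_chromaticSymm {V : Type*} [Fintype V] (G : SimpleGraph V) :
    ∃ c, IsSchurExpansion (chromaticSymm G) c :=
  exists_isSchurExpansion (isSymm_chromaticSymm G) (Fintype.card V)
    fun _ => degree_eq_of_coeff_chromaticSymm_ne_zero G

/-! ### Jacobi–Trudi determinants with entries vanishing beyond `E 2` -/

/-- The determinant of the matrix `E_{c_i - i + j}` of size `m`. -/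
def jtDet {R : Type*} [CommRing R] (E : ℤ → R) (c : ℕ → ℤ) (m : ℕ) : R :=
  Matrix.det (Matrix.of fun i j : Fin m => E (c i - (i : ℤ) + (j : ℤ)))

section

variable {R : Type*} [CommRing R] {E : ℤ → R} {x y : R}

theorem jtDet_eq_zero (h3 : ∀ k, 3 ≤ k → E k = 0) {c : ℕ → ℤ} {m : ℕ} (hm : 0 < m)
    (hc : 3 ≤ c 0) : jtDet E c m = 0 := by
  refine Matrix.det_eq_zero_of_row_eq_zero ⟨0, hm⟩ fun j => h3 _ ?_
  simp only [Nat.cast_zero]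
  omega

theorem jtDet_succ (h3 : ∀ k, 3 ≤ k → E k = 0) {c : ℕ → ℤ} (m : ℕ) (hc : c 0 = 2) :
    jtDet E c (m + 1) = E 2 * jtDet E (fun i => c (i + 1)) m := by
  rw [jtDet, Matrix.det_succ_row_zero, Fin.sum_univ_succ, sum_eq_zero, add_zero]
  · simp only [Fin.val_zero, pow_zero, one_mul, Matrix.of_apply, hc, Nat.cast_zero, sub_zero,
      add_zero]
    congr 2
    ext i j
    simp only [Matrix.submatrix_apply, Matrix.of_apply, Fin.val_succ, Fin.zero_succAbove]
    congr 1
    push_cast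
    ring
  · intro j _
    rw [Matrix.of_apply, h3, mul_zero, zero_mul]
    simp only [Fin.val_zero, Fin.val_succ, hc]
    push_cast
    omega

/-- The first row is (E 1, E 2, 0, …), and the minor at E 2 has first column (1, 0, …). -/
theorem jtDet_one_succ_succ (h0 : E 0 = 1) (hneg : ∀ k < 0, E k = 0) (h3 : ∀ k, 3 ≤ k → E k = 0)
    (n : ℕ) : jtDet E (fun _ => 1) (n + 2) =
      E 1 * jtDet E (fun _ => 1) (n + 1) - E 2 * jtDet E (fun _ => 1) n := by
  rw [jtDet, Matrix.det_succ_row_zero, Fin.sum_univ_succ, Fin.sum_univ_succ, sum_eq_zero, add_zero]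
  · have hA : Matrix.det ((Matrix.of fun i j : Fin (n + 2) =>
        E (1 - (i : ℤ) + (j : ℤ))).submatrix Fin.succ (Fin.succAbove 0)) =
        jtDet E (fun _ => 1) (n + 1) := by
      rw [jtDet]
      congr 1
      ext i j
      simp only [Matrix.submatrix_apply, Matrix.of_apply, Fin.val_succ, Fin.zero_succAbove]
      congr 1
      push_cast
      ring
    have hB : Matrix.det ((Matrix.of fun i j : Fin (n + 2) =>
        E (1 - (i : ℤ) + (j : ℤ))).submatrix Fin.succ (Fin.succAbove (Fin.succ 0))) =
        jtDet E (fun _ => 1) n := by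
      rw [Matrix.det_succ_column_zero, Fin.sum_univ_succ, sum_eq_zero, add_zero]
      · simp only [Fin.val_zero, pow_zero, one_mul, Matrix.submatrix_apply, Matrix.of_apply]
        rw [jtDet]
        have : E (1 - ((Fin.succ (0 : Fin (n + 1)) : Fin (n + 2)) : ℤ) +
            ((Fin.succAbove (Fin.succ 0) (0 : Fin (n + 1)) : Fin (n + 2)) : ℤ)) = 1 := by
          simp [h0, Fin.succAbove]
        rw [this, one_mul]
        congr 1
        ext i j
        simp only [Matrix.submatrix_apply, Matrix.of_apply, Fin.val_succ, Fin.zero_succAbove,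
          Fin.succ_succAbove_succ]
        congr 1
        push_cast
        ring
      · intro i _
        rw [Matrix.submatrix_apply, Matrix.of_apply, hneg, mul_zero, zero_mul]
        simp [Fin.succAbove]
        omega
    rw [hA, hB]
    simp
    ring
  · intro j _
    rw [Matrix.of_apply, h3, mul_zero, zero_mul]
    simp only [Fin.val_zero, Fin.val_succ]
    push_cast
    omega

/-- The recurrence has characteristic roots x and y. Two consecutive values are carried for the
two-step induction, and the factor x - y avoids division. -/
theorem sub_mul_jtDet_one (h0 : E 0 = 1) (h1 : E 1 = x + y) (h2 : E 2 = x * y)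
    (hneg : ∀ k < 0, E k = 0) (h3 : ∀ k, 3 ≤ k → E k = 0) (n : ℕ) :
    (x - y) * jtDet E (fun _ => 1) n = x ^ (n + 1) - y ^ (n + 1) ∧
      (x - y) * jtDet E (fun _ => 1) (n + 1) = x ^ (n + 2) - y ^ (n + 2) := by
  induction n with
  | zero =>
    constructor
    · simp [jtDet]
    · simp [jtDet, h1]
      ring
  | succ n ih =>
    refine ⟨ih.2, ?_⟩
    rw [jtDet_one_succ_succ h0 hneg h3, h1, h2]
    linear_combination (x + y) * ih.2 - x * y * ih.1

theorem jtDet_congr {c c' : ℕ → ℤ} {m : ℕ} (h : ∀ i < m, c i = c' i) :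
    jtDet E c m = jtDet E c' m := by
  rw [jtDet, jtDet]
  congr 1
  ext i j
  rw [Matrix.of_apply, Matrix.of_apply, h i i.2]

theorem jtDet_two_one (h3 : ∀ k, 3 ≤ k → E k = 0) (p q : ℕ) : ∀ c : ℕ → ℤ,
    (∀ i < q, c i = 2) → (∀ i, q ≤ i → i < q + p → c i = 1) →
    jtDet E c (q + p) = E 2 ^ q * jtDet E (fun _ => 1) p := by
  induction q with
  | zero =>
    intro c _ hc
    rw [zero_add, pow_zero, one_mul]
    exact jtDet_congr fun i hi => hc i (Nat.zero_le i) (by omega)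
  | succ q ih =>
    intro c h2 h1
    rw [show q + 1 + p = q + p + 1 by ring, jtDet_succ h3 _ (h2 0 (by omega)),
      ih _ (fun i hi => h2 _ (by omega)) (fun i hi hi' => h1 _ (by omega) (by omega)), pow_succ]
    ring

end

/-! ### Schur functions in two variables -/

/-- Specialization of a power series to two indeterminates, all others being set to zero. -/
def twoVar : MvPowerSeries ℕ ℚ →ₐ[ℚ] MvPowerSeries (Fin 2) ℚ :=
  MvPowerSeries.killCompl Fin.valEmbedding

/-- The exponent vector `(a, b)` in two indeterminates. -/
def expVec (a b : ℕ) : Fin 2 →₀ ℕ := Finsupp.single 0 a + Finsupp.single 1 b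

theorem expVec_inj {a b a' b' : ℕ} : expVec a b = expVec a' b' ↔ a = a' ∧ b = b' := by
  refine ⟨fun h => ?_, fun h => by rw [h.1, h.2]⟩
  have h0 := DFunLike.congr_fun h 0
  have h1 := DFunLike.congr_fun h 1
  simpa [expVec] using And.intro h0 h1

theorem coeff_twoVar (f : MvPowerSeries ℕ ℚ) (a b : ℕ) :
    MvPowerSeries.coeff (expVec a b) (twoVar f) =
      MvPowerSeries.coeff (Finsupp.single 0 a + Finsupp.single 1 b) f := by
  rw [twoVar, MvPowerSeries.coeff_killCompl, expVec, Finsupp.embDomain_add,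
    Finsupp.embDomain_single, Finsupp.embDomain_single]
  rfl

theorem embDomain_sum_single_valEmbedding (T : Finset (Fin 2)) :
    (∑ i ∈ T, Finsupp.single i 1 : Fin 2 →₀ ℕ).embDomain Fin.valEmbedding =
      indVec (T.map Fin.valEmbedding) := by
  rw [Finsupp.embDomain_eq_mapDomain, Finsupp.mapDomain_finsetSum]
  simp [Finsupp.mapDomain_single, indVec]

theorem twoVar_elemSymm (k : ℕ) : twoVar (elemSymm k) =
    ∑ T ∈ powersetCard k (univ : Finset (Fin 2)),
      MvPowerSeries.monomial (∑ i ∈ T, Finsupp.single i 1) 1 := by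
  classical
  ext d
  rw [twoVar, MvPowerSeries.coeff_killCompl, map_sum]
  by_cases h : ∃ T : Finset (Fin 2), T.card = k ∧ d = ∑ i ∈ T, Finsupp.single i 1
  · obtain ⟨T, rfl, rfl⟩ := h
    rw [embDomain_sum_single_valEmbedding, sum_eq_single T]
    · rw [MvPowerSeries.coeff_monomial_same]
      simpa using coeff_elemSymm_indVec (T.map Fin.valEmbedding)
    · intro T' _ hT
      rw [MvPowerSeries.coeff_monomial, if_neg]
      intro h
      have := congrArg (Finsupp.embDomain Fin.valEmbedding) h
      rw [embDomain_sum_single_valEmbedding, embDomain_sum_single_valEmbedding] at this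
      exact hT (map_injective _ (indVec_injective this)).symm
    · simp
  · rw [sum_eq_zero]
    · by_contra h0
      obtain ⟨S, hS, hd⟩ := exists_of_coeff_elemSymm_ne_zero h0
      have hsub : ∀ j ∈ S, j < 2 := by
        intro j hj
        by_contra hlt
        have := DFunLike.congr_fun hd j
        rw [indVec_apply, if_pos hj, Finsupp.embDomain_of_notMem_range] at this
        · exact zero_ne_one this
        · rintro ⟨i, rfl⟩
          exact hlt i.2
      obtain ⟨T, rfl⟩ : ∃ T : Finset (Fin 2), T.map Fin.valEmbedding = S :=
        ⟨S.attachFin hsub, by ext; simp⟩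
      rw [← embDomain_sum_single_valEmbedding] at hd
      exact h ⟨T, by simpa using hS, Finsupp.embDomain_injective _ hd⟩
    · intro T hT
      rw [MvPowerSeries.coeff_monomial, if_neg]
      rintro rfl
      exact h ⟨T, (mem_powersetCard.1 hT).2, rfl⟩

theorem twoVar_elemSymmInt_zero : twoVar (elemSymmInt 0) = 1 := by
  rw [show (0 : ℤ) = (0 : ℕ) by rfl, elemSymmInt_natCast, twoVar_elemSymm]
  simp

theorem twoVar_elemSymmInt_one :
    twoVar (elemSymmInt 1) = MvPowerSeries.X 0 + MvPowerSeries.X 1 := by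
  rw [show (1 : ℤ) = (1 : ℕ) by rfl, elemSymmInt_natCast, twoVar_elemSymm]
  rw [show powersetCard 1 (univ : Finset (Fin 2)) = {{0}, {1}} by decide]
  rw [sum_pair (by decide)]
  simp [MvPowerSeries.X]

theorem twoVar_elemSymmInt_two :
    twoVar (elemSymmInt 2) = MvPowerSeries.X 0 * MvPowerSeries.X 1 := by
  rw [show (2 : ℤ) = (2 : ℕ) by rfl, elemSymmInt_natCast, twoVar_elemSymm]
  rw [show powersetCard 2 (univ : Finset (Fin 2)) = {{0, 1}} by decide]
  rw [sum_singleton, sum_pair (by decide)]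
  simp [MvPowerSeries.X, MvPowerSeries.monomial_mul_monomial]

theorem twoVar_elemSymmInt_of_three_le (k : ℤ) (hk : 3 ≤ k) : twoVar (elemSymmInt k) = 0 := by
  lift k to ℕ using by omega
  rw [elemSymmInt_natCast, twoVar_elemSymm, powersetCard_eq_empty.2, sum_empty]
  simp
  omega

theorem twoVar_elemSymmInt_of_neg (k : ℤ) (hk : k < 0) : twoVar (elemSymmInt k) = 0 := by
  rw [elemSymmInt_of_neg hk, map_zero]

theorem twoVar_schur (μ : YoungDiagram) : twoVar (schur μ) =
    jtDet (fun k => twoVar (elemSymmInt k)) (fun i => μ.colLen i) (μ.rowLen 0) := by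
  rw [schur, AlgHom.map_det]
  rfl

theorem twoVar_schur_eq_zero {μ : YoungDiagram} (h : 2 < length μ) : twoVar (schur μ) = 0 := by
  rw [twoVar_schur]
  refine jtDet_eq_zero twoVar_elemSymmInt_of_three_le ?_ (by simp only [length] at h; omega)
  rw [← YoungDiagram.mem_iff_lt_rowLen, YoungDiagram.mem_iff_lt_colLen]
  simp only [length] at h
  omega

theorem monomial_expVec (a b : ℕ) : (MvPowerSeries.monomial (expVec a b) 1 :
    MvPowerSeries (Fin 2) ℚ) = MvPowerSeries.X 0 ^ a * MvPowerSeries.X 1 ^ b := by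
  rw [MvPowerSeries.X_pow_eq, MvPowerSeries.X_pow_eq, MvPowerSeries.monomial_mul_monomial, one_mul]
  rfl

/-- The first μ_2 columns have length 2 and contribute (xy)^μ_2; the remaining μ_1 - μ_2 have length
1 and contribute a complete homogeneous polynomial. -/
theorem sub_mul_twoVar_schur {μ : YoungDiagram} (h : length μ ≤ 2) :
    (MvPowerSeries.X 0 - MvPowerSeries.X 1) * twoVar (schur μ) =
      MvPowerSeries.monomial (expVec (μ.rowLen 0 + 1) (μ.rowLen 1)) 1 -
        MvPowerSeries.monomial (expVec (μ.rowLen 1) (μ.rowLen 0 + 1)) 1 := by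
  obtain ⟨p, hp⟩ := Nat.exists_eq_add_of_le (μ.rowLen_anti 0 1 zero_le_one)
  rw [length] at h
  have hcol : ∀ i, μ.colLen i ≤ 2 := fun i => (μ.colLen_anti 0 i (Nat.zero_le i)).trans h
  have hiff : ∀ r i, r < μ.colLen i ↔ i < μ.rowLen r := fun r i => by
    rw [← YoungDiagram.mem_iff_lt_rowLen, YoungDiagram.mem_iff_lt_colLen]
  rw [twoVar_schur, hp, jtDet_two_one twoVar_elemSymmInt_of_three_le]
  · have := (sub_mul_jtDet_one (E := fun k => twoVar (elemSymmInt k)) twoVar_elemSymmInt_zero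
      twoVar_elemSymmInt_one twoVar_elemSymmInt_two twoVar_elemSymmInt_of_neg
      twoVar_elemSymmInt_of_three_le p).1
    rw [monomial_expVec, monomial_expVec, twoVar_elemSymmInt_two, mul_left_comm, this]
    ring
  · intro i hi
    have := (hiff 1 i).2 hi
    have := hcol i
    norm_cast
    omega
  · intro i hi hi'
    have := (hiff 0 i).2 (by omega)
    have := (hiff 1 i).not.2 (by omega)
    norm_cast
    omega

/-! ### Extracting Schur coefficients of length at most two -/

/-- The coefficient of `x^(μ_1 + 1) y^μ_2` in `(x - y) f(x, y)`. -/
def twoRowCoeff (μ : YoungDiagram) : MvPowerSeries ℕ ℚ →ₗ[ℚ] ℚ :=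
  MvPowerSeries.coeff (expVec (μ.rowLen 0 + 1) (μ.rowLen 1)) ∘ₗ
    LinearMap.mulLeft ℚ (MvPowerSeries.X 0 - MvPowerSeries.X 1) ∘ₗ twoVar.toLinearMap

theorem twoRowCoeff_apply (μ : YoungDiagram) (f : MvPowerSeries ℕ ℚ) : twoRowCoeff μ f =
    MvPowerSeries.coeff (expVec (μ.rowLen 0 + 1) (μ.rowLen 1))
      ((MvPowerSeries.X 0 - MvPowerSeries.X 1) * twoVar f) := rfl

theorem eq_of_rowLen_eq {μ ν : YoungDiagram} (hμ : length μ ≤ 2) (hν : length ν ≤ 2)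
    (h0 : μ.rowLen 0 = ν.rowLen 0) (h1 : μ.rowLen 1 = ν.rowLen 1) : μ = ν := by
  have hz : ∀ κ : YoungDiagram, length κ ≤ 2 → ∀ i, κ.rowLen (i + 2) = 0 := by
    intro κ hκ i
    by_contra h
    have : (i + 2, 0) ∈ κ := YoungDiagram.mem_iff_lt_rowLen.2 (Nat.pos_of_ne_zero h)
    rw [YoungDiagram.mem_iff_lt_colLen] at this
    rw [length] at hκ
    omega
  refine rowVec_injective (Finsupp.ext fun i => ?_)
  rw [rowVec_apply, rowVec_apply]
  match i with
  | 0 => exact h0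
  | 1 => exact h1
  | i + 2 => rw [hz μ hμ, hz ν hν]

open Classical in
theorem twoRowCoeff_schur {μ ν : YoungDiagram} (hμ : length μ ≤ 2) :
    twoRowCoeff μ (schur ν) = if ν = μ then 1 else 0 := by
  rw [twoRowCoeff_apply]
  rcases le_or_gt (length ν) 2 with hν | hν
  · rw [sub_mul_twoVar_schur hν, map_sub, MvPowerSeries.coeff_monomial, MvPowerSeries.coeff_monomial]
    have := μ.rowLen_anti 0 1 zero_le_one
    have := ν.rowLen_anti 0 1 zero_le_one
    -- The subtracted monomial has the smaller exponent on x, so it cannot match.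
    rw [if_neg (c := expVec (μ.rowLen 0 + 1) (μ.rowLen 1) = expVec (ν.rowLen 1) (ν.rowLen 0 + 1))
      (fun h => by rw [expVec_inj] at h; omega), sub_zero]
    refine if_congr ⟨fun h => ?_, ?_⟩ rfl rfl
    · rw [expVec_inj] at h
      exact eq_of_rowLen_eq hν hμ (by omega) (by omega)
    · rintro rfl
      rfl
  · rw [twoVar_schur_eq_zero hν, mul_zero, map_zero, if_neg]
    rintro rfl
    omega

theorem IsSchurExpansion.schurCoeff_eq_twoRowCoeff {f : MvPowerSeries ℕ ℚ} {c : YoungDiagram →₀ ℚ}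
    (h : IsSchurExpansion f c) {μ : YoungDiagram} (hμ : length μ ≤ 2) :
    schurCoeff f μ = twoRowCoeff μ f := by
  classical
  rw [h.schurCoeff_eq μ]
  conv_rhs => rw [h]
  rw [Finsupp.sum, map_sum]
  simp only [map_smul, twoRowCoeff_schur hμ, smul_eq_mul, mul_ite, mul_one, mul_zero]
  rw [Finset.sum_ite_eq']
  split_ifs with hc
  · rfl
  · simpa using hc

theorem coeff_X_zero_mul (f : MvPowerSeries (Fin 2) ℚ) (a b : ℕ) :
    MvPowerSeries.coeff (expVec (a + 1) b) (MvPowerSeries.X 0 * f) =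
      MvPowerSeries.coeff (expVec a b) f := by
  have : expVec (a + 1) b = Finsupp.single 0 1 + expVec a b := by
    rw [expVec, expVec, ← add_assoc, ← Finsupp.single_add, add_comm 1 a]
  rw [this, MvPowerSeries.X, MvPowerSeries.coeff_add_monomial_mul, one_mul]

theorem coeff_X_one_mul (f : MvPowerSeries (Fin 2) ℚ) (a b : ℕ) :
    MvPowerSeries.coeff (expVec a (b + 1)) (MvPowerSeries.X 1 * f) =
      MvPowerSeries.coeff (expVec a b) f := by
  have : expVec a (b + 1) = Finsupp.single 1 1 + expVec a b := by
    rw [expVec, expVec, add_left_comm, ← Finsupp.single_add, add_comm 1 b]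
  rw [this, MvPowerSeries.X, MvPowerSeries.coeff_add_monomial_mul, one_mul]

theorem coeff_X_one_mul_eq_zero (f : MvPowerSeries (Fin 2) ℚ) (a : ℕ) :
    MvPowerSeries.coeff (expVec a 0) (MvPowerSeries.X 1 * f) = 0 := by
  rw [MvPowerSeries.X, MvPowerSeries.coeff_monomial_mul, if_neg]
  intro h
  simpa [expVec] using h 1

theorem twoRowCoeff_of_rowLen_one_eq_zero {μ : YoungDiagram} (h : μ.rowLen 1 = 0)
    (f : MvPowerSeries ℕ ℚ) : twoRowCoeff μ f =
      MvPowerSeries.coeff (Finsupp.single 0 (μ.rowLen 0) + Finsupp.single 1 0) f := by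
  rw [twoRowCoeff_apply, h, sub_mul, map_sub, coeff_X_zero_mul, coeff_X_one_mul_eq_zero, sub_zero,
    coeff_twoVar]

theorem twoRowCoeff_of_rowLen_one_eq_succ {μ : YoungDiagram} {b : ℕ} (h : μ.rowLen 1 = b + 1)
    (f : MvPowerSeries ℕ ℚ) : twoRowCoeff μ f =
      MvPowerSeries.coeff (Finsupp.single 0 (μ.rowLen 0) + Finsupp.single 1 (b + 1)) f -
      MvPowerSeries.coeff (Finsupp.single 0 (μ.rowLen 0 + 1) + Finsupp.single 1 b) f := by
  rw [twoRowCoeff_apply, h, sub_mul, map_sub, coeff_X_zero_mul, coeff_X_one_mul, coeff_twoVar,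
    coeff_twoVar]

/-! ### Bipartitions and the chromatic symmetric function -/

section Graph

variable {V : Type*} {G : SimpleGraph V}

theorem IsBipartition.symm {A B : Set V} (h : IsBipartition G A B) : IsBipartition G B A :=
  ⟨h.1.symm, h.2.2, h.2.1⟩

theorem IsBipartition.mem_iff_notMem {A B : Set V} (h : IsBipartition G A B) (v : V) :
    v ∈ B ↔ v ∉ A := by
  rw [← h.1.compl_eq, Set.mem_compl_iff]

theorem IsBipartition.mem_iff_of_adj {A B : Set V} (h : IsBipartition G A B) {v w : V}
    (hvw : G.Adj v w) : w ∈ A ↔ v ∉ A := by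
  constructor
  · exact fun hw hv => h.2.1 hv hw hvw.ne hvw
  · intro hv
    by_contra hw
    rw [← h.mem_iff_notMem] at hv hw
    exact h.2.2 hv hw hvw.ne hvw

theorem IsBipartition.isBipartite {A B : Set V} (h : IsBipartition G A B) : G.IsBipartite := by
  classical
  refine ⟨SimpleGraph.Coloring.mk (fun v => if v ∈ A then 0 else 1) fun {v w} hvw => ?_⟩
  have := h.mem_iff_of_adj hvw
  by_cases hv : v ∈ A <;> by_cases hw : w ∈ A <;> simp_all

theorem exists_isBipartition (h : G.IsBipartite) : ∃ A B, IsBipartition G A B := by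
  obtain ⟨κ⟩ := h
  refine ⟨{v | κ v = 0}, {v | κ v = 0}ᶜ, isCompl_compl, ?_, ?_⟩
  · intro v hv w hw _ hvw
    exact κ.valid hvw (hv.trans hw.symm)
  · intro v hv w hw _ hvw
    have := κ.valid hvw
    simp only [Set.mem_compl_iff, Set.mem_ofPred_eq] at hv hw
    omega

/-- Crossing an edge flips membership in both A and C, so their agreement is constant along walks.
-/
theorem IsBipartition.mem_iff_of_reachable {A B C D : Set V} (h : IsBipartition G A B)
    (h' : IsBipartition G C D) {v w : V} (hvw : G.Reachable v w) :
    (v ∈ A ↔ v ∈ C) ↔ (w ∈ A ↔ w ∈ C) := by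
  obtain ⟨p⟩ := hvw
  induction p with
  | nil => rfl
  | cons hadj _ ih =>
    rw [← ih, h.mem_iff_of_adj hadj, h'.mem_iff_of_adj hadj]
    tauto

theorem IsBipartition.eq_or_eq_swap {A B C D : Set V} (hG : G.Connected)
    (h : IsBipartition G A B) (h' : IsBipartition G C D) : (C = A ∧ D = B) ∨ (C = B ∧ D = A) := by
  obtain ⟨v⟩ := hG.nonempty
  have key := fun w => h.mem_iff_of_reachable h' (hG.preconnected v w)
  by_cases hv : v ∈ A ↔ v ∈ C
  · have hw : ∀ w, w ∈ C ↔ w ∈ A := fun w => ((key w).1 hv).symm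
    refine Or.inl ⟨Set.ext hw, Set.ext fun w => ?_⟩
    rw [h'.mem_iff_notMem, h.mem_iff_notMem, hw]
  · have hw : ∀ w, w ∈ C ↔ w ∉ A := fun w => by
      have := (key w).not.1 hv
      tauto
    refine Or.inr ⟨Set.ext fun w => by rw [h.mem_iff_notMem, hw], Set.ext fun w => ?_⟩
    rw [h'.mem_iff_notMem, hw, not_not]

variable [Fintype V]

theorem sum_single_apply (κ : V → ℕ) (i : ℕ) :
    (∑ v, Finsupp.single (κ v) 1 : ℕ →₀ ℕ) i = {v | κ v = i}.ncard := by
  classical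
  rw [Finsupp.finsetSum_apply, Set.ncard_eq_toFinset_card']
  simp [Finsupp.single_apply]

theorem coeff_chromaticSymm_nonneg (d : ℕ →₀ ℕ) :
    0 ≤ MvPowerSeries.coeff d (chromaticSymm G) := by
  rw [chromaticSymm, coeff_monomialSum]
  exact Nat.cast_nonneg _

theorem exists_isBipartition_of_coeff_ne_zero {a b : ℕ} (h : MvPowerSeries.coeff
    (Finsupp.single 0 a + Finsupp.single 1 b) (chromaticSymm G) ≠ 0) :
    ∃ C D : Set V, IsBipartition G C D ∧ C.ncard = a ∧ D.ncard = b := by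
  rw [chromaticSymm, coeff_monomialSum, Nat.cast_ne_zero, Nat.card_ne_zero] at h
  obtain ⟨⟨κ, hκ⟩⟩ := h.1
  have hval : ∀ i, {v | κ v = i}.ncard = (Finsupp.single 0 a + Finsupp.single 1 b : ℕ →₀ ℕ) i :=
    fun i => by rw [← hκ, sum_single_apply]
  have h01 : ∀ v, κ v ≠ 0 → κ v = 1 := by
    intro v h0
    by_contra h1
    have h2 := hval (κ v)
    rw [Finsupp.add_apply, Finsupp.single_eq_of_ne h0, Finsupp.single_eq_of_ne h1,
      add_zero, Set.ncard_eq_zero] at h2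
    exact Set.eq_empty_iff_forall_notMem.1 h2 v rfl
  refine ⟨{v | κ v = 0}, {v | κ v = 1}, ⟨?_, ?_, ?_⟩, ?_, ?_⟩
  · rw [← compl_eq_iff_isCompl]
    ext v
    exact ⟨h01 v, fun h h' => zero_ne_one (h'.symm.trans h)⟩
  · exact fun v hv w hw _ hvw => κ.valid hvw (hv.trans hw.symm)
  · exact fun v hv w hw _ hvw => κ.valid hvw (hv.trans hw.symm)
  · simpa using hval 0
  · simpa using hval 1

theorem IsBipartition.coeff_pos {C D : Set V} (h : IsBipartition G C D) :
    0 < MvPowerSeries.coeff (Finsupp.single 0 C.ncard + Finsupp.single 1 D.ncard)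
      (chromaticSymm G) := by
  classical
  rw [chromaticSymm, coeff_monomialSum, Nat.cast_pos, Nat.card_pos_iff]
  refine ⟨⟨⟨SimpleGraph.Coloring.mk (fun v => if v ∈ C then 0 else 1) fun {v w} hvw => ?_, ?_⟩⟩, ?_⟩
  · have := h.mem_iff_of_adj hvw
    by_cases hv : v ∈ C <;> by_cases hw : w ∈ C <;> simp_all
  · ext i
    rw [sum_single_apply]
    change {v | (if v ∈ C then 0 else 1) = i}.ncard = _
    match i with
    | 0 => simp
    | 1 =>
      have : {v | ¬ v ∈ C} = D := Set.ext fun v => (h.mem_iff_notMem v).symm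
      simp [this]
    | i + 2 =>
      have : {v | (if v ∈ C then 0 else 1) = i + 2} = (∅ : Set V) := by
        refine Set.eq_empty_iff_forall_notMem.2 fun v hv => ?_
        change (if v ∈ C then 0 else 1) = i + 2 at hv
        split_ifs at hv
        omega
      rw [this]
      simp
  -- `Nat.card` is 0 on infinite types, so positivity also needs finiteness: all colors lie in the
  -- support of d.
  · set d : ℕ →₀ ℕ := Finsupp.single 0 C.ncard + Finsupp.single 1 D.ncard
    have hmem : ∀ κ : {κ : G.Coloring ℕ // ∑ v, Finsupp.single (κ v) 1 = d}, ∀ v,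
        κ.1 v ∈ d.support := by
      intro κ v
      have hv := DFunLike.congr_fun κ.2 (κ.1 v)
      rw [sum_single_apply] at hv
      rw [Finsupp.mem_support_iff, ← hv]
      exact Set.ncard_ne_zero_of_mem (a := v) rfl
    refine Finite.of_injective (β := V → d.support) (fun κ v => ⟨κ.1 v, hmem κ v⟩) fun κ κ' hκ => ?_
    refine Subtype.ext (DFunLike.ext _ _ fun v => ?_)
    exact congrArg Subtype.val (congrFun hκ v)

theorem schurCoeff_chromaticSymm {μ : YoungDiagram} (hμ : length μ ≤ 2) :
    schurCoeff (chromaticSymm G) μ = twoRowCoeff μ (chromaticSymm G) := by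
  obtain ⟨c, hc⟩ := exists_isSchurExpansion_chromaticSymm G
  exact hc.schurCoeff_eq_twoRowCoeff hμ

theorem isTwoSchurZero_of_not_isBipartite (hG : ¬ G.IsBipartite) :
    IsTwoSchurZero (chromaticSymm G) := by
  have hz : ∀ a b, MvPowerSeries.coeff (Finsupp.single 0 a + Finsupp.single 1 b)
      (chromaticSymm G) = 0 := by
    intro a b
    by_contra h
    obtain ⟨C, D, hCD, -⟩ := exists_isBipartition_of_coeff_ne_zero h
    exact hG hCD.isBipartite
  intro μ hμ
  rw [schurCoeff_chromaticSymm hμ]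
  rcases h : μ.rowLen 1 with _ | b
  · rw [twoRowCoeff_of_rowLen_one_eq_zero h, hz]
  · rw [twoRowCoeff_of_rowLen_one_eq_succ h, hz, hz, sub_zero]

theorem exists_twoRow {a b : ℕ} (h : b ≤ a) :
    ∃ μ : YoungDiagram, length μ ≤ 2 ∧ μ.rowLen 0 = a ∧ μ.rowLen 1 = b := by
  have hanti : Antitone (Finsupp.single 0 a + Finsupp.single 1 b : ℕ →₀ ℕ) := by
    refine antitone_nat_of_succ_le fun i => ?_
    match i with
    | 0 => simpa using h
    | i + 1 => simp
  obtain ⟨μ, hμ⟩ := exists_rowVec_eq hanti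
  have hrow : ∀ i, μ.rowLen i = (Finsupp.single 0 a + Finsupp.single 1 b : ℕ →₀ ℕ) i :=
    fun i => by rw [← hμ, rowVec_apply]
  refine ⟨μ, ?_, by simp [hrow], by simp [hrow]⟩
  by_contra! hlt
  have : (2, 0) ∈ μ := YoungDiagram.mem_iff_lt_colLen.2 hlt
  rw [YoungDiagram.mem_iff_lt_rowLen, hrow] at this
  simp at this

theorem IsBipartition.isTwoSchurPositive_iff (hG : G.Connected) {A B : Set V}
    (h : IsBipartition G A B) (hAB : B.ncard ≤ A.ncard) :
    IsTwoSchurPositive (chromaticSymm G) ↔ A.ncard ≤ B.ncard + 1 := by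
  have htype : ∀ a b, MvPowerSeries.coeff (Finsupp.single 0 a + Finsupp.single 1 b)
      (chromaticSymm G) ≠ 0 → (a = A.ncard ∧ b = B.ncard) ∨ (a = B.ncard ∧ b = A.ncard) := by
    intro a b hab
    obtain ⟨C, D, hCD, rfl, rfl⟩ := exists_isBipartition_of_coeff_ne_zero hab
    rcases h.eq_or_eq_swap hG hCD with ⟨rfl, rfl⟩ | ⟨rfl, rfl⟩
    · exact Or.inl ⟨rfl, rfl⟩
    · exact Or.inr ⟨rfl, rfl⟩
  constructor
  · intro hpos
    by_contra! hlt
    -- At the shape (k-1, l+1) the subtracted coefficient is that of x^k y^l, which is positive,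
    -- while the other vanishes because (k-1, l+1) is neither (k,l) nor (l,k).
    obtain ⟨μ, hμ, h0, h1⟩ := exists_twoRow (a := A.ncard - 1) (b := B.ncard + 1) (by omega)
    have := hpos μ hμ
    rw [schurCoeff_chromaticSymm hμ, twoRowCoeff_of_rowLen_one_eq_succ h1, h0,
      Nat.sub_add_cancel (by omega)] at this
    have hz : MvPowerSeries.coeff (Finsupp.single 0 (A.ncard - 1) + Finsupp.single 1 (B.ncard + 1))
        (chromaticSymm G) = 0 := by
      by_contra hne
      have := htype _ _ hne
      omega
    have := h.coeff_pos
    linarith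
  · intro hle μ hμ
    rw [schurCoeff_chromaticSymm hμ]
    rcases h1 : μ.rowLen 1 with _ | b
    · rw [twoRowCoeff_of_rowLen_one_eq_zero h1]
      exact coeff_chromaticSymm_nonneg _
    -- Here b + 1 ≤ μ_1, so the exponents μ_1 + 1 and b differ by at least two, unlike the parts of
    -- a balanced bipartition.
    · have hz : MvPowerSeries.coeff (Finsupp.single 0 (μ.rowLen 0 + 1) + Finsupp.single 1 b)
          (chromaticSymm G) = 0 := by
        by_contra hne
        have := htype _ _ hne
        have := μ.rowLen_anti 0 1 zero_le_one
        omega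
      rw [twoRowCoeff_of_rowLen_one_eq_succ h1, hz, sub_zero]
      exact coeff_chromaticSymm_nonneg _

end Graph

end ChromaticSchur

end

theorem mainTheorem5 {V : Type*} [Fintype V] (G : SimpleGraph V) :
    (∃! c : YoungDiagram →₀ ℚ,
      ChromaticSchur.IsSchurExpansion (ChromaticSchur.chromaticSymm G) c) ∧
    (G.Connected → G.IsBipartite →
      ∃ A B : Set V,
        ChromaticSchur.IsBipartition G A B ∧
        (∀ C D : Set V, ChromaticSchur.IsBipartition G C D →
          (C = A ∧ D = B) ∨ (C = B ∧ D = A)) ∧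
        B.ncard ≤ A.ncard ∧
        (ChromaticSchur.IsTwoSchurPositive (ChromaticSchur.chromaticSymm G) ↔
          A.ncard ≤ B.ncard + 1) ∧
        (¬ ChromaticSchur.IsTwoSchurPositive (ChromaticSchur.chromaticSymm G) ↔
          B.ncard + 2 ≤ A.ncard)) ∧
    (¬ G.IsBipartite → ChromaticSchur.IsTwoSchurZero (ChromaticSchur.chromaticSymm G)) := by
  refine ⟨?_, ?_, ChromaticSchur.isTwoSchurZero_of_not_isBipartite⟩
  · obtain ⟨c, hc⟩ := ChromaticSchur.exists_isSchurExpansion_chromaticSymm G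
    exact ⟨c, hc, fun c' hc' => hc'.unique hc⟩
  · intro hconn hbip
    obtain ⟨A, B, hAB, hle⟩ : ∃ A B : Set V, ChromaticSchur.IsBipartition G A B ∧
        B.ncard ≤ A.ncard := by
      obtain ⟨A, B, hAB⟩ := ChromaticSchur.exists_isBipartition hbip
      rcases le_total B.ncard A.ncard with h | h
      · exact ⟨A, B, hAB, h⟩
      · exact ⟨B, A, hAB.symm, h⟩
    have hiff := hAB.isTwoSchurPositive_iff hconn hle
    refine ⟨A, B, hAB, fun C D hCD => hAB.eq_or_eq_swap hconn hCD, hle, hiff, ?_⟩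
    rw [hiff]
    omega
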